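/- Consider the two-action task offloading problem, where in each time slot $n=0,1,2,\dots$ a user either computes its task locally (arm 1) or offloads it to the server (arm 2). Arm $i$ returns a reward with probability $r_i\in[0,1]$ and a penalty with probability $1-r_i$. The Bayesian learning automaton (BLA) keeps a state $s^n=(\alpha_1^n,\beta_1^n,\alpha_2^n,\beta_2^n)$, with $s^0=(1,1,1,1)$. In slot $n$ it draws, given the past, independent samples $X_1\sim\mathrm{Beta}(\alpha_1^n,\beta_1^n)$ and $X_2\sim\mathrm{Beta}(\alpha_2^n,\beta_2^n)$, chooses local computing if $X_1>X_2$ and offloading otherwise, receives the feedback of the chosen arm $i$ (a reward with conditional probability $r_i$ given the past and the samples), and increases $\alpha_i$ by $1$ on a reward and $\beta_i$ by $1$ on a penalty; the parameters of the other arm are unchanged. The probability of selecting local computing in state $s=(\alpha_1,\beta_1,\alpha_2,\beta_2)$ is $$p_1^{s}=\frac{(\alpha_1+\beta_1-1)!\,(\alpha_2+\beta_2-1)!}{(\alpha_1-1)!\,(\beta_1-1)!\,(\alpha_1+\beta_1+\alpha_2+\beta_2-2)!}\sum_{j=\alpha_2}^{\alpha_2+\beta_2-1}\frac{(j+\alpha_1-1)!\,(\beta_1+\alpha_2+\beta_2-j-2)!}{j!\,(\alpha_2+\beta_2-1-j)!}.$$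 **Theorem.** If $r_1>r_2$, then the BLA converges to choosing only the optimal action (local computing): almost surely $\lim_{n\to\infty}p_1^{s^n}=1$, and consequently the unconditional probability that local computing is selected in slot $n$ also tends to $1$ as $n\to\infty$. -/

import Mathlib

open MeasureTheory ProbabilityTheory Filter
open scoped Nat Topology ProbabilityTheory

/-- The two actions: computing the task locally (arm 1) or offloading it (arm 2). -/
inductive Arm
  | localComputing
  | offloading

/-- State `(α₁, β₁, α₂, β₂)` of the Bayesian learning automaton: the parameters of the
Beta distributions attached to arm 1 and to arm 2. -/
@[ext]
structure BLAState where
  α₁ : ℕ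
  β₁ : ℕ
  α₂ : ℕ
  β₂ : ℕ

namespace BLA

/-- All four parameters start at `1`. -/
def initState : BLAState := ⟨1, 1, 1, 1⟩

/-- Given a pair of samples `(x₁, x₂)`, local computing is chosen if `x₁ > x₂`, and offloading
otherwise. -/
noncomputable def choose (x : ℝ × ℝ) : Arm :=
  if x.1 > x.2 then Arm.localComputing else Arm.offloading

/-- Parameter update of the chosen arm: `α + 1` on a reward (`true`), `β + 1` on a penalty
(`false`). The parameters of the other arm do not change. -/
def update (s : BLAState) : Arm → Bool → BLAState
  | Arm.localComputing, true => { s with α₁ := s.α₁ + 1 }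
  | Arm.localComputing, false => { s with β₁ := s.β₁ + 1 }
  | Arm.offloading, true => { s with α₂ := s.α₂ + 1 }
  | Arm.offloading, false => { s with β₂ := s.β₂ + 1 }

/-- State at time slot `n`, when `x k` is the pair of samples drawn in slot `k` and `f k` is the
feedback received in slot `k`. -/
noncomputable def state (x : ℕ → ℝ × ℝ) (f : ℕ → Bool) : ℕ → BLAState
  | 0 => initState
  | n + 1 => update (state x f n) (choose (x n)) (f n)

/-- Joint law `Beta(α₁, β₁) ⊗ Beta(α₂, β₂)` of the two independent samples drawn in state `s`. -/
noncomputable def sampleLaw (s : BLAState) : Measure (ℝ × ℝ) :=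
  (betaMeasure s.α₁ s.β₁).prod (betaMeasure s.α₂ s.β₂)

/-- Probability that the environment rewards a given action. -/
def rewardProb (r₁ r₂ : ℝ) : Arm → ℝ
  | Arm.localComputing => r₁
  | Arm.offloading => r₂

/-- The probability `p₁` of selecting local computing in state `s`, in closed form.
All subtractions are exact as soon as the four parameters are positive, which they are in every
state that the automaton visits. -/
noncomputable def probLocal (s : BLAState) : ℝ :=
  (((s.α₁ + s.β₁ - 1)! : ℝ) * ((s.α₂ + s.β₂ - 1)! : ℝ)) /
      (((s.α₁ - 1)! : ℝ) * ((s.β₁ - 1)! : ℝ) * ((s.α₁ + s.β₁ + s.α₂ + s.β₂ - 2)! : ℝ)) *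
    ∑ j ∈ Finset.Icc s.α₂ (s.α₂ + s.β₂ - 1),
      (((j + s.α₁ - 1)! : ℝ) * ((s.β₁ + s.α₂ + s.β₂ - j - 2)! : ℝ)) /
        ((j ! : ℝ) * ((s.α₂ + s.β₂ - 1 - j)! : ℝ))

/-- `X n` (the pair of samples drawn in slot `n`) and `F n` (the feedback received in slot `n`,
`true` being a reward) form a run of the Bayesian learning automaton in an environment that
rewards local computing with probability `r₁` and offloading with probability `r₂`. The σ-algebra
`ℱ n` is the information available at the beginning of slot `n`. -/
structure IsRun {Ω : Type*} [mΩ : MeasurableSpace Ω] (μ : Measure Ω) (ℱ : Filtration ℕ mΩ)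
    (r₁ r₂ : ℝ) (X : ℕ → Ω → ℝ × ℝ) (F : ℕ → Ω → Bool) : Prop where
  measurable_sample : ∀ n, Measurable[ℱ (n + 1)] (X n)
  measurable_feedback : ∀ n, Measurable[ℱ (n + 1)] (F n)
  /-- Given the past, the samples are drawn from the two current Beta distributions,
  independently of each other. -/
  sample_law : ∀ n, ∀ B : Set (ℝ × ℝ), MeasurableSet B →
    μ⟦X n ⁻¹' B | ℱ n⟧ =ᵐ[μ]
      fun ω => (sampleLaw (state (fun k => X k ω) (fun k => F k ω) n)).real B
  /-- Given the past and the current samples, the feedback is a reward with the reward probability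
  of the chosen action. -/
  feedback_law : ∀ n,
    μ⟦F n ⁻¹' {true} | ℱ n ⊔ MeasurableSpace.comap (X n) inferInstance⟧ =ᵐ[μ]
      fun ω => rewardProb r₁ r₂ (choose (X n ω))

end BLA

/-! The closed form is the chance that the first sample beats the second (`probLocal_eq`), hence the
conditional probability of local computing given the past. By Lévy's conditional Borel–Cantelli
lemma, an arm chosen only finitely often has selection probability tending to 0
(`ae_tendsto_condExp_indicator_zero`). An arm chosen infinitely often has empirical mean tending to
its reward probability, by a martingale strong law normalised by the number of plays
(`ae_tendsto_sum_div_count`); its Beta law then concentrates there by Chebyshev.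

If arm 1 were played finitely often, its Beta parameters would freeze while arm 2 concentrates at
r₂. The frozen law charges (r₂ + δ, 1), so the selection probability of arm 1 would stay away from
0, a contradiction. So arm 1 is played infinitely often. If arm 2 is played finitely often, its
selection probability vanishes; otherwise both laws concentrate, at r₁ > r₂, and arm 1 wins with
probability tending to 1. Dominated convergence gives the unconditional statement. -/

namespace BLA

/-! ### Beta laws with positive integer parameters: moments and distribution function. -/

lemma measurable_betaPDF (α β : ℝ) : Measurable (betaPDF α β) :=
  (measurable_betaPDFReal α β).ennreal_ofReal

lemma beta_natCast_add_one (m n : ℕ) :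
    beta ((m + 1 : ℕ) : ℝ) ((n + 1 : ℕ) : ℝ) = (m ! * n ! : ℝ) / (m + n + 1)! := by
  have h : ((m + 1 : ℕ) : ℝ) + ((n + 1 : ℕ) : ℝ) = ((m + n + 1 : ℕ) : ℝ) + 1 := by
    push_cast; ring
  rw [beta, h, Real.Gamma_nat_eq_factorial]
  push_cast
  rw [Real.Gamma_nat_eq_factorial, Real.Gamma_nat_eq_factorial]

/-- The density of the Beta distribution with parameters `m + 1` and `n + 1` on `(0, 1)`. -/
noncomputable def betaDensity (m n : ℕ) (x : ℝ) : ℝ :=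
  ((m + n + 1)! : ℝ) / (m ! * n !) * (x ^ m * (1 - x) ^ n)

lemma betaPDFReal_natCast_add_one (m n : ℕ) :
    betaPDFReal ((m + 1 : ℕ) : ℝ) ((n + 1 : ℕ) : ℝ) =
      (Set.Ioo (0 : ℝ) 1).indicator (betaDensity m n) := by
  ext x
  rw [betaPDFReal, beta_natCast_add_one, Set.indicator_apply]
  simp only [Set.mem_Ioo]
  split_ifs with hx
  · rw [betaDensity]
    push_cast
    rw [add_sub_cancel_right, add_sub_cancel_right, Real.rpow_natCast, Real.rpow_natCast, one_div,
      inv_div]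
    ring
  · rfl

lemma betaPDFReal_nonneg (m n : ℕ) (x : ℝ) :
    0 ≤ betaPDFReal ((m + 1 : ℕ) : ℝ) ((n + 1 : ℕ) : ℝ) x := by
  by_cases hx : 0 < x ∧ x < 1
  · exact (betaPDFReal_pos hx.1 hx.2 (by positivity) (by positivity)).le
  · rw [betaPDFReal, if_neg hx]

lemma integral_betaMeasure (m n : ℕ) (g : ℝ → ℝ) :
    ∫ x, g x ∂(betaMeasure ((m + 1 : ℕ) : ℝ) ((n + 1 : ℕ) : ℝ)) =
      ∫ x in (0 : ℝ)..1, betaDensity m n x * g x := by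
  rw [betaMeasure, integral_withDensity_eq_integral_toReal_smul]
  · simp only [betaPDF, ENNReal.toReal_ofReal (betaPDFReal_nonneg m n _), smul_eq_mul]
    rw [betaPDFReal_natCast_add_one, intervalIntegral.integral_of_le zero_le_one,
      integral_Ioc_eq_integral_Ioo, ← integral_indicator measurableSet_Ioo]
    congr 1 with x
    simp only [Set.indicator_apply]
    split_ifs <;> simp
  · exact (measurable_betaPDF _ _)
  · exact ae_of_all _ fun x => ENNReal.ofReal_lt_top

instance isProbabilityMeasure_betaMeasure_natCast (m n : ℕ) :
    IsProbabilityMeasure (betaMeasure ((m + 1 : ℕ) : ℝ) ((n + 1 : ℕ) : ℝ)) :=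
  isProbabilityMeasureBeta (by positivity) (by positivity)

lemma integral_pow_mul_one_sub_pow (m n : ℕ) :
    ∫ x in (0 : ℝ)..1, x ^ m * (1 - x) ^ n = (m ! * n ! : ℝ) / (m + n + 1)! := by
  have h := integral_betaMeasure m n (fun _ => 1)
  simp only [integral_const, probReal_univ, smul_eq_mul, mul_one, betaDensity,
    intervalIntegral.integral_const_mul] at h
  have h1 : (m ! : ℝ) ≠ 0 := by positivity
  have h2 : (n ! : ℝ) ≠ 0 := by positivity
  have h3 : ((m + n + 1)! : ℝ) ≠ 0 := by positivity
  field_simp at h ⊢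
  linarith

lemma integral_betaMeasure_pow (m n j k : ℕ) :
    ∫ x, x ^ j * (1 - x) ^ k ∂(betaMeasure ((m + 1 : ℕ) : ℝ) ((n + 1 : ℕ) : ℝ)) =
      ((m + n + 1)! : ℝ) / (m ! * n !) * (((m + j)! * (n + k)! : ℝ) / (m + j + (n + k) + 1)!) := by
  rw [integral_betaMeasure, ← integral_pow_mul_one_sub_pow, ← intervalIntegral.integral_const_mul]
  congr 1 with x
  rw [betaDensity]
  ring

lemma ae_mem_Ioo_betaMeasure (m n : ℕ) :
    ∀ᵐ x ∂(betaMeasure ((m + 1 : ℕ) : ℝ) ((n + 1 : ℕ) : ℝ)), x ∈ Set.Ioo (0 : ℝ) 1 := by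
  rw [betaMeasure, ae_withDensity_iff (measurable_betaPDF _ _)]
  refine ae_of_all _ fun x hx => ?_
  contrapose! hx
  rw [betaPDF, betaPDFReal_natCast_add_one, Set.indicator_of_notMem hx, ENNReal.ofReal_zero]

lemma integrable_betaMeasure_of_continuous (m n : ℕ) {g : ℝ → ℝ} (hg : Continuous g) :
    Integrable g (betaMeasure ((m + 1 : ℕ) : ℝ) ((n + 1 : ℕ) : ℝ)) := by
  obtain ⟨C, hC⟩ := (isCompact_Icc (a := (0 : ℝ)) (b := 1)).exists_bound_of_continuousOn
    hg.continuousOn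
  refine Integrable.of_bound hg.aestronglyMeasurable C ?_
  filter_upwards [ae_mem_Ioo_betaMeasure m n] with x hx using hC x (Set.Ioo_subset_Icc_self hx)

/-- The distribution function of the Beta distribution as a sum of Bernstein polynomials. -/
noncomputable def betaCDFPolynomial (m n : ℕ) : Polynomial ℝ :=
  ∑ j ∈ Finset.Icc (m + 1) (m + n + 1), bernsteinPolynomial ℝ (m + n + 1) j

lemma eval_betaCDFPolynomial (m n : ℕ) (x : ℝ) :
    (betaCDFPolynomial m n).eval x = ∑ j ∈ Finset.Icc (m + 1) (m + n + 1),
      ((m + n + 1).choose j : ℝ) * (x ^ j * (1 - x) ^ (m + n + 1 - j)) := by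
  simp [betaCDFPolynomial, Polynomial.eval_finsetSum, bernsteinPolynomial, mul_assoc]

/-- Derivatives of Bernstein polynomials are differences of neighbours one degree lower, so the sum
telescopes; the upper end vanishes because its index exceeds the degree. -/
lemma eval_derivative_betaCDFPolynomial (m n : ℕ) (x : ℝ) :
    (betaCDFPolynomial m n).derivative.eval x = betaDensity m n x := by
  have h : ∀ k, (∑ j ∈ Finset.Ico (m + 1) (m + 1 + k),
      bernsteinPolynomial ℝ (m + n + 1) j).derivative =
        (m + n + 1 : ℕ) * (bernsteinPolynomial ℝ (m + n) m - bernsteinPolynomial ℝ (m + n) (m + k))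
          := by
    intro k
    induction k with
    | zero => simp
    | succ k ih =>
      rw [← add_assoc, Finset.sum_Ico_succ_top (by omega), Polynomial.derivative_add, ih,
        show m + 1 + k = (m + k) + 1 by ring, bernsteinPolynomial.derivative_succ]
      rw [Nat.add_sub_cancel, ← add_assoc]
      ring
  have h2 := h (n + 1)
  rw [bernsteinPolynomial.eq_zero_of_lt ℝ (show m + n < m + (n + 1) by omega), sub_zero] at h2
  have h3 : Finset.Icc (m + 1) (m + n + 1) = Finset.Ico (m + 1) (m + 1 + (n + 1)) := by
    ext j; simp; omega
  rw [betaCDFPolynomial, h3, h2, betaDensity]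
  simp only [bernsteinPolynomial, Polynomial.eval_mul, Polynomial.eval_natCast,
    Polynomial.eval_pow, Polynomial.eval_X, Polynomial.eval_sub, Polynomial.eval_one,
    Nat.add_sub_cancel_left]
  rw [Nat.cast_add_choose, Nat.factorial_succ]
  push_cast
  ring

lemma betaMeasure_real_Iio (m n : ℕ) {x : ℝ} (hx : x ∈ Set.Icc (0 : ℝ) 1) :
    (betaMeasure ((m + 1 : ℕ) : ℝ) ((n + 1 : ℕ) : ℝ)).real (Set.Iio x) =
      (betaCDFPolynomial m n).eval x := by
  have h1 : (betaMeasure ((m + 1 : ℕ) : ℝ) ((n + 1 : ℕ) : ℝ)).real (Set.Iio x) =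
      ∫ y in (0 : ℝ)..x, betaDensity m n y := by
    rw [← integral_indicator_one measurableSet_Iio, integral_betaMeasure,
      intervalIntegral.integral_of_le zero_le_one, intervalIntegral.integral_of_le hx.1,
      integral_Ioc_eq_integral_Ioo, integral_Ioc_eq_integral_Ioo,
      ← integral_indicator measurableSet_Ioo, ← integral_indicator measurableSet_Ioo]
    congr 1 with y
    simp only [Set.indicator_apply, Set.mem_Ioo, Set.mem_Iio, Pi.one_apply]
    have := hx.2
    by_cases hy : y < x
    · have : y < 1 := by linarith
      simp [hy, this]
    · simp [hy]
  have h2 : ∀ y ∈ Set.uIcc 0 x, HasDerivAt (fun z => (betaCDFPolynomial m n).eval z)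
      (betaDensity m n y) y := fun y _ => by
    rw [← eval_derivative_betaCDFPolynomial]
    exact (betaCDFPolynomial m n).hasDerivAt y
  have hc : Continuous (betaDensity m n) := by unfold betaDensity; fun_prop
  rw [h1, intervalIntegral.integral_eq_sub_of_hasDerivAt h2 (hc.intervalIntegrable _ _),
    sub_eq_self, eval_betaCDFPolynomial]
  -- The antiderivative vanishes at 0, since only powers with j ≥ m + 1 occur.
  refine Finset.sum_eq_zero fun j hj => ?_
  rw [zero_pow (by simp at hj; omega)]
  simp

/-! ### The closed form as a selection probability. -/

/-- All four parameters of the state are positive. -/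
def _root_.BLAState.Pos (s : BLAState) : Prop := 0 < s.α₁ ∧ 0 < s.β₁ ∧ 0 < s.α₂ ∧ 0 < s.β₂

lemma _root_.BLAState.Pos.exists_eq {s : BLAState} (hs : s.Pos) :
    ∃ a b c d, s = ⟨a + 1, b + 1, c + 1, d + 1⟩ := by
  obtain ⟨a, b, c, d⟩ := s
  obtain ⟨h1, h2, h3, h4⟩ := hs
  exact ⟨a - 1, b - 1, c - 1, d - 1, by simp at *; omega⟩

lemma isProbabilityMeasure_sampleLaw {s : BLAState} (hs : s.Pos) :
    IsProbabilityMeasure (sampleLaw s) := by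
  obtain ⟨a, b, c, d, rfl⟩ := hs.exists_eq
  unfold sampleLaw
  infer_instance

lemma measurableSet_lt_snd_fst : MeasurableSet {x : ℝ × ℝ | x.2 < x.1} :=
  measurableSet_lt measurable_snd measurable_fst

/-- The closed form is the probability that the first sample exceeds the second one. -/
lemma probLocal_eq {s : BLAState} (hs : s.Pos) :
    probLocal s = (sampleLaw s).real {x | x.2 < x.1} := by
  obtain ⟨a, b, c, d, rfl⟩ := hs.exists_eq
  unfold sampleLaw
  dsimp only
  -- Fubini: fix the first sample and use the distribution function of the second. Each Bernstein
  -- term then integrates to a Beta moment.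
  have h1 : ((betaMeasure ((a + 1 : ℕ) : ℝ) ((b + 1 : ℕ) : ℝ)).prod
      (betaMeasure ((c + 1 : ℕ) : ℝ) ((d + 1 : ℕ) : ℝ))).real {x | x.2 < x.1} =
      ∫ x, (betaMeasure ((c + 1 : ℕ) : ℝ) ((d + 1 : ℕ) : ℝ)).real (Set.Iio x)
        ∂(betaMeasure ((a + 1 : ℕ) : ℝ) ((b + 1 : ℕ) : ℝ)) := by
    rw [measureReal_def, Measure.prod_apply measurableSet_lt_snd_fst]
    simp only [measureReal_def]
    rw [integral_toReal]
    · rfl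
    · exact (measurable_measure_prodMk_left measurableSet_lt_snd_fst).aemeasurable
    · exact ae_of_all _ fun x => measure_lt_top _ _
  have h2 : ∫ x, (betaMeasure ((c + 1 : ℕ) : ℝ) ((d + 1 : ℕ) : ℝ)).real (Set.Iio x)
        ∂(betaMeasure ((a + 1 : ℕ) : ℝ) ((b + 1 : ℕ) : ℝ)) =
      ∫ x, (∑ j ∈ Finset.Icc (c + 1) (c + d + 1),
        ((c + d + 1).choose j : ℝ) * (x ^ j * (1 - x) ^ (c + d + 1 - j)))
          ∂(betaMeasure ((a + 1 : ℕ) : ℝ) ((b + 1 : ℕ) : ℝ)) := by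
    refine integral_congr_ae ?_
    filter_upwards [ae_mem_Ioo_betaMeasure a b] with x hx
    rw [betaMeasure_real_Iio c d (Set.Ioo_subset_Icc_self hx), eval_betaCDFPolynomial]
  rw [h1, h2, integral_finsetSum _ fun j _ =>
    integrable_betaMeasure_of_continuous a b (by fun_prop)]
  simp only [integral_const_mul, integral_betaMeasure_pow, probLocal]
  rw [Finset.mul_sum]
  have e : c + 1 + (d + 1) - 1 = c + d + 1 := by omega
  rw [e]
  refine Finset.sum_congr rfl fun j hj => ?_
  obtain ⟨hj1, hj2⟩ := Finset.mem_Icc.1 hj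
  -- With k = c + d + 1 - j, every truncated subtraction in the closed form becomes exact.
  obtain ⟨k, hk⟩ := Nat.exists_eq_add_of_le hj2
  have e1 : a + 1 + (b + 1) - 1 = a + b + 1 := by omega
  have e2 : a + 1 + (b + 1) + (c + 1) + (d + 1) - 2 = a + j + (b + k) + 1 := by omega
  have e3 : j + (a + 1) - 1 = a + j := by omega
  have e4 : b + 1 + (c + 1) + (d + 1) - j - 2 = b + k := by omega
  have e5 : c + d + 1 - j = k := by omega
  rw [e1, e2, e3, e4, e5, hk, Nat.cast_add_choose, Nat.add_sub_cancel, Nat.add_sub_cancel]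
  field_simp

/-! ### Concentration and positivity of Beta laws. -/

lemma variance_betaMeasure_le (m n : ℕ) :
    Var[fun x => x; betaMeasure ((m + 1 : ℕ) : ℝ) ((n + 1 : ℕ) : ℝ)] ≤ 1 / (m + n + 3) ∧
    ∫ x, x ∂(betaMeasure ((m + 1 : ℕ) : ℝ) ((n + 1 : ℕ) : ℝ)) = (m + 1) / (m + n + 2) := by
  have h1 : ∫ x, x ∂(betaMeasure ((m + 1 : ℕ) : ℝ) ((n + 1 : ℕ) : ℝ)) =
      (m + 1) / (m + n + 2) := by
    have h := integral_betaMeasure_pow m n 1 0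
    simp only [pow_one, pow_zero, mul_one] at h
    rw [h, add_zero, show m + 1 + n + 1 = (m + n + 1) + 1 by ring, Nat.factorial_succ m,
      Nat.factorial_succ (m + n + 1)]
    push_cast
    field_simp
    ring
  have h2 : ∫ x, x ^ 2 ∂(betaMeasure ((m + 1 : ℕ) : ℝ) ((n + 1 : ℕ) : ℝ)) =
      (m + 1) * (m + 2) / ((m + n + 2) * (m + n + 3)) := by
    have h := integral_betaMeasure_pow m n 2 0
    simp only [pow_zero, mul_one] at h
    rw [h, add_zero, show m + 2 + n + 1 = (m + n + 1) + 1 + 1 by ring,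
      show m + 2 = m + 1 + 1 by ring, Nat.factorial_succ (m + 1), Nat.factorial_succ m,
      Nat.factorial_succ (m + n + 1 + 1), Nat.factorial_succ (m + n + 1)]
    push_cast
    field_simp
    ring
  refine ⟨?_, h1⟩
  have hL : MemLp (fun x : ℝ => x) 2 (betaMeasure ((m + 1 : ℕ) : ℝ) ((n + 1 : ℕ) : ℝ)) :=
    (memLp_two_iff_integrable_sq continuous_id.aestronglyMeasurable).2
      (integrable_betaMeasure_of_continuous m n (by fun_prop))
  rw [variance_eq_sub hL]
  simp only [Pi.pow_apply]
  rw [h1, h2]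
  have hm : (0 : ℝ) ≤ m := m.cast_nonneg
  have hn : (0 : ℝ) ≤ n := n.cast_nonneg
  -- The variance is p(1 - p)/(m + n + 3) with p the mean; both p and 1 - p are at most 1.
  rw [show ((m : ℝ) + 1) * (m + 2) / ((m + n + 2) * (m + n + 3)) - ((m + 1) / (m + n + 2)) ^ 2
    = ((m + 1) / (m + n + 2)) * ((n + 1) / (m + n + 2)) * (1 / (m + n + 3)) by field_simp; ring]
  refine mul_le_of_le_one_left (by positivity) (mul_le_one₀ ?_ (by positivity) ?_)
  · rw [div_le_one (by positivity)]; linarith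
  · rw [div_le_one (by positivity)]; linarith

/-- Beta distributions concentrate at the limit of their means. -/
lemma tendsto_betaMeasure_real_abs_sub_ge {a b : ℕ → ℕ} (ha : ∀ n, 0 < a n) (hb : ∀ n, 0 < b n)
    {r : ℝ} (hab : Tendsto (fun n => (a n : ℝ) + b n) atTop atTop)
    (hr : Tendsto (fun n => (a n : ℝ) / (a n + b n)) atTop (𝓝 r)) {δ : ℝ} (hδ : 0 < δ) :
    Tendsto (fun n => (betaMeasure (a n) (b n)).real {x | δ ≤ |x - r|}) atTop (𝓝 0) := by
  have hlim : Tendsto (fun n => 1 / ((a n : ℝ) + b n + 1) / (δ / 2) ^ 2) atTop (𝓝 0) := by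
    have := (tendsto_atTop_add_const_right _ (1 : ℝ) hab).inv_tendsto_atTop.div_const ((δ / 2) ^ 2)
    simpa using this
  refine squeeze_zero' (Eventually.of_forall fun n => measureReal_nonneg) ?_ hlim
  -- Half of δ absorbs the distance from the mean to r; Chebyshev handles the other half.
  filter_upwards [Metric.tendsto_nhds.1 hr (δ / 2) (by positivity)] with n hn
  obtain ⟨m, hm⟩ := Nat.exists_eq_add_of_lt (ha n)
  obtain ⟨k, hk⟩ := Nat.exists_eq_add_of_lt (hb n)
  rw [zero_add] at hm hk
  rw [hm, hk] at hn ⊢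
  obtain ⟨hv, he⟩ := variance_betaMeasure_le m k
  have hL : MemLp (fun x : ℝ => x) 2 (betaMeasure ((m + 1 : ℕ) : ℝ) ((k + 1 : ℕ) : ℝ)) :=
    (memLp_two_iff_integrable_sq continuous_id.aestronglyMeasurable).2
      (integrable_betaMeasure_of_continuous m k (by fun_prop))
  have hC := meas_ge_le_variance_div_sq hL (c := δ / 2) (by positivity)
  rw [he] at hC
  have hn' : |((m : ℝ) + 1) / (m + k + 2) - r| < δ / 2 := by
    rw [Real.dist_eq] at hn
    convert hn using 3
    push_cast
    ring
  have hsub : {x : ℝ | δ ≤ |x - r|} ⊆ {x | δ / 2 ≤ |x - ((m : ℝ) + 1) / (m + k + 2)|} := by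
    intro x hx
    simp only [Set.mem_ofPred_eq] at hx ⊢
    have := abs_sub_le x (((m : ℝ) + 1) / (m + k + 2)) r
    linarith
  calc _ ≤ (betaMeasure ((m + 1 : ℕ) : ℝ) ((k + 1 : ℕ) : ℝ)).real
        {x | δ / 2 ≤ |x - ((m : ℝ) + 1) / (m + k + 2)|} := measureReal_mono hsub
    _ ≤ Var[fun x => x; betaMeasure ((m + 1 : ℕ) : ℝ) ((k + 1 : ℕ) : ℝ)] / (δ / 2) ^ 2 :=
        ENNReal.toReal_le_of_le_ofReal (div_nonneg (variance_nonneg _ _) (by positivity)) hC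
    _ ≤ _ := by
        gcongr
        refine hv.trans_eq ?_
        push_cast
        congr 1
        ring

/-- The density is positive on (c, 1), which has positive length. This gives an arm with frozen
parameters a fixed chance of a large sample. -/
lemma betaMeasure_real_Ioi_pos {a b : ℕ} (ha : 0 < a) (hb : 0 < b) {c : ℝ} (hc0 : 0 ≤ c)
    (hc : c < 1) : 0 < (betaMeasure a b).real (Set.Ioi c) := by
  have : IsProbabilityMeasure (betaMeasure a b) :=
    isProbabilityMeasureBeta (by positivity) (by positivity)
  rw [measureReal_def, ENNReal.toReal_pos_iff]
  refine ⟨pos_iff_ne_zero.2 fun h0 => ?_, measure_lt_top _ _⟩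
  rw [betaMeasure, withDensity_apply_eq_zero (measurable_betaPDF _ _)] at h0
  have : volume (Set.Ioo c 1) ≤ 0 := by
    rw [← h0]
    refine measure_mono fun x hx => ⟨?_, hx.1⟩
    have := betaPDFReal_pos (α := a) (β := b) (hc0.trans_lt hx.1) hx.2 (by positivity)
      (by positivity)
    simpa [betaPDF] using this
  simp at this
  linarith

/-! ### Kronecker's lemma and a martingale strong law along random counts. -/

/-- The Kronecker lemma on weighted sums, for a monotone sequence of weights. -/
lemma tendsto_sum_div_of_tendsto_sum_div {a b : ℕ → ℝ} (hb : Monotone b) (hb0 : ∀ n, 0 < b n)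
    (hbt : Tendsto b atTop atTop) {l : ℝ}
    (h : Tendsto (fun n => ∑ k ∈ Finset.range n, a k / b k) atTop (𝓝 l)) :
    Tendsto (fun n => (∑ k ∈ Finset.range n, a k) / b n) atTop (𝓝 0) := by
  set u : ℕ → ℝ := fun n => (∑ k ∈ Finset.range n, a k / b k) - l with hu
  have hu0 : Tendsto u atTop (𝓝 0) := by simpa [hu] using h.sub_const l
  -- Abel summation against u, the partial sums minus their limit. What remains is a weighted
  -- average of a null sequence.
  have habel : ∀ n, ∑ k ∈ Finset.range n, a k =
      b n * u n - b 0 * u 0 - ∑ k ∈ Finset.range n, (b (k + 1) - b k) * u (k + 1) := by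
    intro n
    induction n with
    | zero => simp
    | succ n ih =>
      have : u (n + 1) = u n + a n / b n := by simp only [hu, Finset.sum_range_succ]; ring
      have h2 : b n * (a n / b n) = a n := mul_div_cancel₀ _ (hb0 n).ne'
      rw [Finset.sum_range_succ, ih, Finset.sum_range_succ, this]
      linear_combination -h2
  have hsum : ∀ n, ∑ k ∈ Finset.range n, (b (k + 1) - b k) = b n - b 0 := fun n =>
    Finset.sum_range_sub b n
  have hlo : (fun n => ∑ k ∈ Finset.range n, (b (k + 1) - b k) * u (k + 1)) =o[atTop]
      fun n => ∑ k ∈ Finset.range n, (b (k + 1) - b k) := by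
    refine Asymptotics.IsLittleO.sum_range ?_ (fun k => sub_nonneg.2 (hb k.le_succ)) ?_
    · have := (Asymptotics.isBigO_refl (fun k => b (k + 1) - b k) atTop).mul_isLittleO
        ((Asymptotics.isLittleO_one_iff ℝ).2 ((tendsto_add_atTop_iff_nat 1).2 hu0))
      simpa using this
    · simp only [hsum]
      exact tendsto_atTop_add_const_right _ _ hbt
  have hlo2 : (fun n => ∑ k ∈ Finset.range n, (b (k + 1) - b k) * u (k + 1)) =o[atTop] b := by
    refine hlo.trans_isBigO (Asymptotics.IsBigO.of_bound 1 (Eventually.of_forall fun n => ?_))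
    rw [hsum, Real.norm_of_nonneg (sub_nonneg.2 (hb n.zero_le)), Real.norm_of_nonneg (hb0 n).le]
    linarith [hb0 0]
  have hconst : Tendsto (fun n => b 0 * u 0 / b n) atTop (𝓝 0) := hbt.const_div_atTop _
  have := (hu0.sub hconst).sub hlo2.tendsto_div_nhds_zero
  simp only [sub_zero] at this
  refine this.congr fun n => ?_
  rw [habel n, sub_div, sub_div, mul_div_cancel_left₀ _ (hb0 n).ne']

variable {Ω : Type*}

/-- The number of indices `k < n` with `ω ∈ A k`. -/
noncomputable def count (A : ℕ → Set Ω) (n : ℕ) (ω : Ω) : ℝ :=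
  ∑ k ∈ Finset.range n, (A k).indicator 1 ω

lemma count_succ (A : ℕ → Set Ω) (n : ℕ) (ω : Ω) :
    count A (n + 1) ω = count A n ω + (A n).indicator 1 ω := Finset.sum_range_succ _ _

lemma count_nonneg (A : ℕ → Set Ω) (n : ℕ) (ω : Ω) : 0 ≤ count A n ω :=
  Finset.sum_nonneg fun _ _ => Set.indicator_nonneg (fun _ _ => zero_le_one) _

lemma monotone_count (A : ℕ → Set Ω) (ω : Ω) : Monotone fun n => count A n ω :=
  monotone_nat_of_le_succ fun n => by
    rw [count_succ]
    exact le_add_of_nonneg_right (Set.indicator_nonneg (fun _ _ => zero_le_one) _)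

/-- Each occurrence raises the count c by 1, and 1/(c + 2)² ≤ 1/(c + 1) - 1/(c + 2), so the sum
telescopes. This yields the uniform L² bound for the normalised martingale. -/
lemma sum_indicator_div_sq_le (A : ℕ → Set Ω) (n : ℕ) (ω : Ω) :
    ∑ k ∈ Finset.range n, (A k).indicator (1 : Ω → ℝ) ω / (count A k ω + 2) ^ 2 +
      1 / (count A n ω + 1) ≤ 1 := by
  induction n with
  | zero => simp [count]
  | succ n ih =>
    refine le_trans ?_ ih
    rw [Finset.sum_range_succ, count_succ, add_assoc]
    gcongr
    have := count_nonneg A n ω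
    by_cases h : ω ∈ A n
    · simp only [Set.indicator_of_mem h, Pi.one_apply]
      rw [div_add_div _ _ (by positivity) (by positivity), div_le_div_iff₀ (by positivity)
        (by positivity)]
      nlinarith
    · simp [Set.indicator_of_notMem h]

variable [mΩ : MeasurableSpace Ω] {ℱ : Filtration ℕ mΩ}

lemma measurable_count {A : ℕ → Set Ω} (hA : ∀ n, MeasurableSet[ℱ (n + 1)] (A n)) (n : ℕ) :
    Measurable[ℱ n] (count A n) := by
  refine Finset.measurable_fun_sum _ fun k hk => ?_
  have h : Measurable[ℱ (k + 1)] ((A k).indicator (1 : Ω → ℝ)) :=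
    Measurable.indicator measurable_const (hA k)
  exact h.mono (ℱ.mono (Finset.mem_range.1 hk)) le_rfl

variable {μ : Measure Ω} [IsProbabilityMeasure μ]

/-- A strong law of large numbers for bounded martingale differences that vanish off an adapted
sequence of events. -/
lemma ae_tendsto_sum_div_count {A : ℕ → Set Ω} (hA : ∀ n, MeasurableSet[ℱ (n + 1)] (A n))
    {Y : ℕ → Ω → ℝ} (hY : ∀ n, Measurable[ℱ (n + 1)] (Y n))
    (hYA : ∀ n ω, |Y n ω| ≤ (A n).indicator 1 ω) (hc : ∀ n, μ[Y n | ℱ n] =ᵐ[μ] 0) :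
    ∀ᵐ ω ∂μ, Tendsto (fun n => count A n ω) atTop atTop →
      Tendsto (fun n => (∑ k ∈ Finset.range n, Y k ω) / (count A n ω + 2)) atTop (𝓝 0) := by
  -- The count before slot n is known at time n, so dividing by it preserves the martingale
  -- difference property.
  set D : ℕ → Ω → ℝ := fun n ω => Y n ω / (count A n ω + 2) with hD
  set M : ℕ → Ω → ℝ := fun n ω => ∑ k ∈ Finset.range n, D k ω with hM
  have hcm : ∀ n, Measurable[ℱ n] (fun ω => (count A n ω + 2)⁻¹) := fun n =>
    ((measurable_count hA n).add_const 2).inv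
  have hDm : ∀ n, Measurable[ℱ (n + 1)] (D n) := fun n =>
    (hY n).div (((measurable_count hA n).mono (ℱ.mono n.le_succ) le_rfl).add_const 2)
  have hMm : ∀ n, Measurable[ℱ n] (M n) := fun n =>
    Finset.measurable_fun_sum _ fun k hk =>
      (hDm k).mono (ℱ.mono (Finset.mem_range.1 hk)) le_rfl
  have hDA : ∀ n ω, |D n ω| ≤ (A n).indicator 1 ω / (count A n ω + 2) := fun n ω => by
    have := count_nonneg A n ω
    rw [hD, abs_div, abs_of_pos (show 0 < count A n ω + 2 by linarith)]
    gcongr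
    exact hYA n ω
  have hind : ∀ n ω, (A n).indicator (1 : Ω → ℝ) ω ≤ 1 := fun n ω =>
    Set.indicator_le_self' (fun _ _ => zero_le_one) ω
  have hD1 : ∀ n ω, |D n ω| ≤ 1 := fun n ω => by
    have := count_nonneg A n ω
    refine (hDA n ω).trans ((div_le_one (by linarith)).2 ?_)
    linarith [hind n ω]
  have hMn : ∀ n ω, |M n ω| ≤ n := fun n ω => by
    refine (Finset.abs_sum_le_sum_abs _ _).trans ((Finset.sum_le_sum fun k _ => hD1 k ω).trans ?_)
    simp
  have hDi : ∀ n, Integrable (D n) μ := fun n =>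
    Integrable.of_bound ((hDm n).mono (ℱ.le _) le_rfl).aestronglyMeasurable 1
      (ae_of_all _ (hD1 n))
  have hMi : ∀ n, Integrable (M n) μ := fun n =>
    Integrable.of_bound ((hMm n).mono (ℱ.le _) le_rfl).aestronglyMeasurable n
      (ae_of_all _ (hMn n))
  have hYi : ∀ n, Integrable (Y n) μ := fun n =>
    Integrable.of_bound ((hY n).mono (ℱ.le _) le_rfl).aestronglyMeasurable 1
      (ae_of_all _ fun ω => (hYA n ω).trans (hind n ω))
  have hcD : ∀ n, μ[D n | ℱ n] =ᵐ[μ] 0 := fun n => by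
    have h1 : D n = (fun ω => (count A n ω + 2)⁻¹) * Y n := by
      ext ω; simp [hD, div_eq_inv_mul]
    have h2 := condExp_mul_of_stronglyMeasurable_left (μ := μ) (hcm n).stronglyMeasurable
      (h1 ▸ hDi n) (hYi n)
    rw [h1]
    filter_upwards [h2, hc n] with ω h3 h4
    simp [h3, h4]
  have hmart : Martingale M ℱ μ := by
    refine martingale_of_condExp_sub_eq_zero_nat (fun n => (hMm n).stronglyMeasurable) hMi
      fun n => ?_
    have : M (n + 1) - M n = D n := by
      ext ω; simp [hM, Finset.sum_range_succ]
    rw [this]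
    exact hcD n
  have hMDi : ∀ n, Integrable (M n * D n) μ := fun n =>
    (hDi n).bdd_mul (c := n) (hMi n).aestronglyMeasurable (ae_of_all _ (hMn n))
  have hDDi : ∀ n, Integrable (fun ω => D n ω ^ 2) μ := fun n => by
    have := (hDi n).bdd_mul (c := 1) (hDi n).aestronglyMeasurable (ae_of_all _ (hD1 n))
    simpa [sq] using this
  have hMMi : ∀ n, Integrable (fun ω => M n ω ^ 2) μ := fun n => by
    have := (hMi n).bdd_mul (c := n) (hMi n).aestronglyMeasurable (ae_of_all _ (hMn n))
    simpa [sq] using this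
  have hMD : ∀ n, ∫ ω, M n ω * D n ω ∂μ = 0 := fun n => by
    have h2 := condExp_mul_of_stronglyMeasurable_left (μ := μ) (hMm n).stronglyMeasurable
      (hMDi n) (hDi n)
    have h3 : μ[M n * D n | ℱ n] =ᵐ[μ] 0 := by
      filter_upwards [h2, hcD n] with ω h3 h4
      simp [h3, h4]
    have h4 := integral_condExp (μ := μ) (f := M n * D n) (ℱ.le n)
    rw [integral_congr_ae h3] at h4
    simpa using h4.symm
  -- Orthogonality of martingale increments: cross terms integrate to 0.
  have hMsq : ∀ n, ∫ ω, M n ω ^ 2 ∂μ = ∫ ω, ∑ k ∈ Finset.range n, D k ω ^ 2 ∂μ := by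
    intro n
    induction n with
    | zero => simp [hM]
    | succ n ih =>
      have h1 : ∀ ω, M (n + 1) ω ^ 2 = (M n ω ^ 2 + 2 * (M n ω * D n ω)) + D n ω ^ 2 := fun ω => by
        simp only [hM, Finset.sum_range_succ]; ring
      simp only [h1, Finset.sum_range_succ]
      have hMDi' : Integrable (fun ω => 2 * (M n ω * D n ω)) μ := (hMDi n).const_mul 2
      have hMM' : Integrable (fun ω => M n ω ^ 2 + 2 * (M n ω * D n ω)) μ := (hMMi n).add hMDi'
      rw [integral_add hMM' (hDDi n),
        integral_add (hMMi n) hMDi', integral_const_mul, hMD, ih,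
        integral_add (integrable_finsetSum _ fun k _ => hDDi k) (hDDi n)]
      ring
  have hMsq1 : ∀ n, ∫ ω, M n ω ^ 2 ∂μ ≤ 1 := fun n => by
    rw [hMsq]
    refine (integral_mono (integrable_finsetSum _ fun k _ => hDDi k)
      (integrable_const 1) fun ω => ?_).trans_eq (by simp)
    have h1 := sum_indicator_div_sq_le A n ω
    have h2 : 0 ≤ 1 / (count A n ω + 1) := by have := count_nonneg A n ω; positivity
    refine le_trans (Finset.sum_le_sum fun k _ => ?_) (by linarith :
      ∑ k ∈ Finset.range n, (A k).indicator (1 : Ω → ℝ) ω / (count A k ω + 2) ^ 2 ≤ 1)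
    rw [← sq_abs]
    refine (pow_le_pow_left₀ (abs_nonneg _) (hDA k ω) 2).trans_eq ?_
    rw [div_pow]
    by_cases h : ω ∈ A k <;> simp [h]
  have hbdd : ∀ n, eLpNorm (M n) 1 μ ≤ (1 : NNReal) := fun n => by
    rw [eLpNorm_one_eq_lintegral_enorm, ← ofReal_integral_norm_eq_lintegral_enorm (hMi n)]
    refine ENNReal.ofReal_le_of_le_toReal ?_
    -- From L² to L¹ by |x| ≤ (1 + x²)/2.
    have h1 : ∫ ω, ‖M n ω‖ ∂μ ≤ ∫ ω, (1 / 2 + M n ω ^ 2 * (1 / 2)) ∂μ := by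
      refine integral_mono (hMi n).norm ((integrable_const _).add ((hMMi n).mul_const _))
        fun ω => ?_
      rw [Real.norm_eq_abs]
      nlinarith [sq_nonneg (|M n ω| - 1), sq_abs (M n ω)]
    rw [integral_add (integrable_const _) ((hMMi n).mul_const _), integral_mul_const] at h1
    have := hMsq1 n
    simp at h1 ⊢
    linarith
  filter_upwards [hmart.submartingale.exists_ae_tendsto_of_bdd hbdd] with ω ⟨l, hl⟩ ht
  exact tendsto_sum_div_of_tendsto_sum_div (b := fun n => count A n ω + 2)
    (fun i j hij => by simpa using monotone_count A ω hij)
    (fun n => by have := count_nonneg A n ω; linarith) (tendsto_atTop_add_const_right _ _ ht) hl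

/-! ### Conditional Borel–Cantelli. -/

/-- If an adapted sequence of events occurs only finitely often, the sum of their conditional
probabilities converges, so these tend to zero. -/
lemma ae_tendsto_condExp_indicator_zero {A : ℕ → Set Ω}
    (hA : ∀ n, MeasurableSet[ℱ (n + 1)] (A n)) :
    ∀ᵐ ω ∂μ, Tendsto (fun n => count A n ω) atTop atTop ∨
      Tendsto (fun n => (μ⟦A n | ℱ n⟧) ω) atTop (𝓝 0) := by
  -- Shift by one, since `A n` is only known at time n + 1; the empty set fills index 0.
  let s : ℕ → Set Ω := fun n => Nat.casesOn n ∅ A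
  have hs : ∀ n, MeasurableSet[ℱ n] (s n) := fun n => by
    cases n with
    | zero => exact @MeasurableSet.empty _ (ℱ 0)
    | succ n => exact hA n
  have hnn : ∀ᵐ ω ∂μ, ∀ n, 0 ≤ (μ⟦A n | ℱ n⟧) ω := ae_all_iff.2 fun n =>
    condExp_nonneg (ae_of_all _ fun ω => Set.indicator_nonneg (fun _ _ => zero_le_one) ω)
  filter_upwards [tendsto_sum_indicator_atTop_iff' (μ := μ) hs, hnn] with ω h1 h2
  by_cases h : Tendsto (fun n => count A n ω) atTop atTop
  · exact Or.inl h
  · refine Or.inr ?_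
    change ∀ n, 0 ≤ (μ[(s (n + 1)).indicator (1 : Ω → ℝ) | ℱ n]) ω at h2
    have h3 := (not_congr h1).1 h
    rw [← not_summable_iff_tendsto_nat_atTop_of_nonneg h2, not_not] at h3
    exact h3.tendsto_atTop_zero

end BLA

/-! ### Pathwise bookkeeping of states and plays. -/

/-- The first Beta parameter attached to a given arm. -/
def BLAState.alpha (s : BLAState) : Arm → ℕ
  | Arm.localComputing => s.α₁
  | Arm.offloading => s.α₂

/-- The second Beta parameter attached to a given arm. -/
def BLAState.beta (s : BLAState) : Arm → ℕ
  | Arm.localComputing => s.β₁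
  | Arm.offloading => s.β₂

namespace BLA

lemma choose_eq_localComputing {x : ℝ × ℝ} : choose x = Arm.localComputing ↔ x.2 < x.1 := by
  unfold choose; split_ifs <;> simp_all

lemma choose_eq_offloading {x : ℝ × ℝ} : choose x = Arm.offloading ↔ x.1 ≤ x.2 := by
  unfold choose; split_ifs <;> simp_all

lemma measurableSet_choose_eq (i : Arm) : MeasurableSet {x | choose x = i} := by
  cases i with
  | localComputing => simpa only [choose_eq_localComputing] using measurableSet_lt_snd_fst
  | offloading =>
    simpa only [choose_eq_offloading] using measurableSet_le measurable_fst measurable_snd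

lemma pos_state (x : ℕ → ℝ × ℝ) (f : ℕ → Bool) (n : ℕ) : (state x f n).Pos := by
  induction n with
  | zero => exact ⟨one_pos, one_pos, one_pos, one_pos⟩
  | succ n ih =>
    obtain ⟨h1, h2, h3, h4⟩ := ih
    rw [state]
    cases choose (x n) <;> cases f n <;> simp [update, BLAState.Pos, *]

lemma monotone_alpha_state (x : ℕ → ℝ × ℝ) (f : ℕ → Bool) (i : Arm) :
    Monotone fun n => (state x f n).alpha i := by
  refine monotone_nat_of_le_succ fun n => ?_
  rw [state]
  cases choose (x n) <;> cases f n <;> cases i <;> simp [update, BLAState.alpha]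

lemma monotone_beta_state (x : ℕ → ℝ × ℝ) (f : ℕ → Bool) (i : Arm) :
    Monotone fun n => (state x f n).beta i := by
  refine monotone_nat_of_le_succ fun n => ?_
  rw [state]
  cases choose (x n) <;> cases f n <;> cases i <;> simp [update, BLAState.beta]

section Run

variable {Ω : Type*} {X : ℕ → Ω → ℝ × ℝ} {F : ℕ → Ω → Bool}

/-- The event that arm `i` is chosen in slot `n`. -/
def chosen (X : ℕ → Ω → ℝ × ℝ) (i : Arm) (n : ℕ) : Set Ω := X n ⁻¹' {x | choose x = i}

/-- The centered reward received from arm `i` in slot `n`; it vanishes if the other arm is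
chosen. -/
noncomputable def centeredReward (X : ℕ → Ω → ℝ × ℝ) (F : ℕ → Ω → Bool) (i : Arm) (r : ℝ) (n : ℕ) :
    Ω → ℝ :=
  (chosen X i n).indicator ((F n ⁻¹' {true}).indicator (fun _ => (1 : ℝ)) - fun _ => r)

lemma alpha_add_beta_state (X : ℕ → Ω → ℝ × ℝ) (F : ℕ → Ω → Bool) (i : Arm) (n : ℕ) (ω : Ω) :
    ((state (fun k => X k ω) (fun k => F k ω) n).alpha i : ℝ) +
      (state (fun k => X k ω) (fun k => F k ω) n).beta i = count (chosen X i) n ω + 2 := by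
  classical
  induction n with
  | zero => cases i <;> simp [state, initState, BLAState.alpha, BLAState.beta, count] <;> norm_num
  | succ n ih =>
    rw [count_succ, add_right_comm, ← ih, state, Set.indicator_apply]
    simp only [chosen, Set.mem_preimage, Set.mem_ofPred_eq]
    cases choose (X n ω) <;> cases F n ω <;> cases i <;>
      simp [update, BLAState.alpha, BLAState.beta] <;> ring

/-- Doob-type splitting of the rewards into r per play plus centered noise. It holds for any r; with
r the arm's reward probability the noise is a martingale. -/
lemma alpha_state (X : ℕ → Ω → ℝ × ℝ) (F : ℕ → Ω → Bool) (i : Arm) (r : ℝ) (n : ℕ) (ω : Ω) :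
    ((state (fun k => X k ω) (fun k => F k ω) n).alpha i : ℝ) =
      1 + r * count (chosen X i) n ω + ∑ k ∈ Finset.range n, centeredReward X F i r k ω := by
  classical
  induction n with
  | zero => cases i <;> simp [state, initState, BLAState.alpha, count]
  | succ n ih =>
    rw [count_succ, Finset.sum_range_succ]
    have h : ((state (fun k => X k ω) (fun k => F k ω) (n + 1)).alpha i : ℝ) =
        (state (fun k => X k ω) (fun k => F k ω) n).alpha i +
          r * (chosen X i n).indicator 1 ω + centeredReward X F i r n ω := by
      rw [state, centeredReward, Set.indicator_apply, Set.indicator_apply]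
      simp only [chosen, Set.mem_preimage, Set.mem_ofPred_eq, Pi.sub_apply, Set.indicator_apply]
      cases choose (X n ω) <;> cases F n ω <;> cases i <;> simp [update, BLAState.alpha]
    rw [h, ih]
    ring

lemma count_chosen_add (X : ℕ → Ω → ℝ × ℝ) (n : ℕ) (ω : Ω) :
    count (chosen X Arm.localComputing) n ω + count (chosen X Arm.offloading) n ω = n := by
  classical
  induction n with
  | zero => simp [count]
  | succ n ih =>
    rw [count_succ, count_succ, Set.indicator_apply, Set.indicator_apply]
    simp only [chosen, Set.mem_preimage, Set.mem_ofPred_eq] at ih ⊢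
    cases choose (X n ω) <;> simp <;> linarith

lemma tendsto_alpha_div (i : Arm) (r : ℝ) {ω : Ω}
    (hc : Tendsto (fun n => count (chosen X i) n ω) atTop atTop)
    (h : Tendsto (fun n => (∑ k ∈ Finset.range n, centeredReward X F i r k ω) /
      (count (chosen X i) n ω + 2)) atTop (𝓝 0)) :
    Tendsto (fun n => ((state (fun k => X k ω) (fun k => F k ω) n).alpha i : ℝ) /
      ((state (fun k => X k ω) (fun k => F k ω) n).alpha i +
        (state (fun k => X k ω) (fun k => F k ω) n).beta i)) atTop (𝓝 r) := by
  -- With c plays and noise S, (1 + rc + S)/(c + 2) = r + (1 - 2r)/(c + 2) + S/(c + 2).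
  have h1 : Tendsto (fun n => (1 - 2 * r) / (count (chosen X i) n ω + 2)) atTop (𝓝 0) :=
    (tendsto_atTop_add_const_right _ _ hc).const_div_atTop _
  have h2 := (h1.add_const r).add h
  simp only [zero_add, add_zero] at h2
  refine h2.congr fun n => ?_
  rw [alpha_add_beta_state, alpha_state X F i r]
  have := count_nonneg (chosen X i) n ω
  field_simp
  ring

/-- If an arm is not chosen infinitely often, its parameters are eventually constant. -/
lemma exists_eventually_eq_of_not_tendsto_count (F : ℕ → Ω → Bool) (i : Arm) {ω : Ω}
    (hc : ¬ Tendsto (fun n => count (chosen X i) n ω) atTop atTop) :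
    ∃ a b : ℕ, ∀ᶠ n in atTop, (state (fun k => X k ω) (fun k => F k ω) n).alpha i = a ∧
      (state (fun k => X k ω) (fun k => F k ω) n).beta i = b := by
  have key : ¬ Tendsto (fun n => (state (fun k => X k ω) (fun k => F k ω) n).alpha i +
      (state (fun k => X k ω) (fun k => F k ω) n).beta i) atTop atTop := fun h => hc <| by
    have h1 := tendsto_atTop_add_const_right _ (-2 : ℝ)
      ((tendsto_natCast_atTop_atTop (R := ℝ)).comp h)
    refine h1.congr fun n => ?_
    have := alpha_add_beta_state X F i n ω
    simp only [Function.comp, Nat.cast_add]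
    linarith
  -- A monotone sequence in ℕ diverges or converges, and convergence in a discrete space means being
  -- eventually constant.
  obtain ha | ⟨a, ha⟩ := tendsto_atTop_of_monotone
    (monotone_alpha_state (fun k => X k ω) (fun k => F k ω) i)
  · exact absurd (tendsto_atTop_mono (fun n => Nat.le_add_right _ _) ha) key
  obtain hb | ⟨b, hb⟩ := tendsto_atTop_of_monotone
    (monotone_beta_state (fun k => X k ω) (fun k => F k ω) i)
  · exact absurd (tendsto_atTop_mono (fun n => Nat.le_add_left _ _) hb) key
  rw [nhds_discrete, tendsto_pure] at ha hb
  exact ⟨a, b, ha.and hb⟩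

lemma tendsto_count_offloading {ω : Ω}
    (hc : ¬ Tendsto (fun n => count (chosen X Arm.localComputing) n ω) atTop atTop) :
    Tendsto (fun n => count (chosen X Arm.offloading) n ω) atTop atTop := by
  -- Play counts do not involve the feedback, so a dummy feedback serves.
  obtain ⟨a, b, hab⟩ := exists_eventually_eq_of_not_tendsto_count (fun _ _ => true) _ hc
  refine (tendsto_atTop_add_const_right _ (2 - (a + b : ℝ))
    (tendsto_natCast_atTop_atTop (R := ℝ))).congr' ?_
  filter_upwards [hab] with n ⟨ha, hb⟩
  have h1 := alpha_add_beta_state X (fun _ _ => true) Arm.localComputing n ω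
  have h2 := count_chosen_add X n ω
  rw [ha, hb] at h1
  linarith

end Run

/-! ### Bounds on the selection probability in a fixed state. -/

section SampleLaw

lemma isProbabilityMeasure_betaMeasure_of_pos {s : BLAState} (hs : s.Pos) (i : Arm) :
    IsProbabilityMeasure (betaMeasure (s.alpha i) (s.beta i)) := by
  obtain ⟨h1, h2, h3, h4⟩ := hs
  cases i <;> exact isProbabilityMeasureBeta (by simpa [BLAState.alpha]) (by simpa [BLAState.beta])

lemma sampleLaw_eq (s : BLAState) :
    sampleLaw s = (betaMeasure (s.alpha Arm.localComputing) (s.beta Arm.localComputing)).prod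
      (betaMeasure (s.alpha Arm.offloading) (s.beta Arm.offloading)) := rfl

lemma sampleLaw_real_choose_offloading {s : BLAState} (hs : s.Pos) :
    (sampleLaw s).real {x | choose x = Arm.offloading} = 1 - probLocal s := by
  have := isProbabilityMeasure_sampleLaw hs
  rw [probLocal_eq hs, ← probReal_compl_eq_one_sub measurableSet_lt_snd_fst]
  congr 1
  ext x
  simp [choose_eq_offloading]

lemma sampleLaw_real_choose_localComputing {s : BLAState} (hs : s.Pos) :
    (sampleLaw s).real {x | choose x = Arm.localComputing} = probLocal s := by
  simp only [probLocal_eq hs, choose_eq_localComputing]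

/-- If both samples lie within δ of their centres, which are 2δ apart, the first one wins; the rest
is a union bound. -/
lemma one_sub_probLocal_le {s : BLAState} (hs : s.Pos) {r₁ r₂ δ : ℝ} (h : r₁ - r₂ = 2 * δ) :
    1 - probLocal s ≤
      (betaMeasure (s.alpha Arm.localComputing) (s.beta Arm.localComputing)).real
        {x | δ ≤ |x - r₁|} +
      (betaMeasure (s.alpha Arm.offloading) (s.beta Arm.offloading)).real {x | δ ≤ |x - r₂|} := by
  have := isProbabilityMeasure_sampleLaw hs
  have h1 := isProbabilityMeasure_betaMeasure_of_pos hs Arm.localComputing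
  have h2 := isProbabilityMeasure_betaMeasure_of_pos hs Arm.offloading
  rw [← sampleLaw_real_choose_offloading hs]
  have hsub : {x : ℝ × ℝ | choose x = Arm.offloading} ⊆
      ({x | δ ≤ |x - r₁|} ×ˢ Set.univ) ∪ (Set.univ ×ˢ {x | δ ≤ |x - r₂|}) := by
    intro x hx
    simp only [Set.mem_ofPred_eq, choose_eq_offloading] at hx
    simp only [Set.mem_union, Set.mem_prod, Set.mem_ofPred_eq, Set.mem_univ, and_true, true_and]
    by_contra! hlt
    have := (abs_lt.1 hlt.1).1
    have := (abs_lt.1 hlt.2).2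
    linarith
  refine (measureReal_mono hsub).trans ((measureReal_union_le _ _).trans_eq ?_)
  rw [sampleLaw_eq, measureReal_prod_prod, measureReal_prod_prod, probReal_univ, probReal_univ,
    mul_one, one_mul]

/-- The first sample wins when it exceeds r + δ and the second is within δ of r; independence gives
the product. This serves when only arm 2 concentrates. -/
lemma le_probLocal {s : BLAState} (hs : s.Pos) (r δ : ℝ) :
    (betaMeasure (s.alpha Arm.localComputing) (s.beta Arm.localComputing)).real (Set.Ioi (r + δ)) *
      (1 - (betaMeasure (s.alpha Arm.offloading) (s.beta Arm.offloading)).real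
        {x | δ ≤ |x - r|}) ≤ probLocal s := by
  have := isProbabilityMeasure_sampleLaw hs
  have h1 := isProbabilityMeasure_betaMeasure_of_pos hs Arm.localComputing
  have h2 := isProbabilityMeasure_betaMeasure_of_pos hs Arm.offloading
  have hm : MeasurableSet {x : ℝ | δ ≤ |x - r|} := measurableSet_le measurable_const (by fun_prop)
  rw [← probReal_compl_eq_one_sub hm, probLocal_eq hs, ← measureReal_prod_prod, ← sampleLaw_eq]
  refine measureReal_mono ?_
  intro x hx
  simp only [Set.mem_prod, Set.mem_Ioi, Set.mem_compl_iff, Set.mem_ofPred_eq, not_le] at hx ⊢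
  have := (abs_lt.1 hx.2).2
  linarith [hx.1]

lemma probLocal_mem_Icc {s : BLAState} (hs : s.Pos) : probLocal s ∈ Set.Icc (0 : ℝ) 1 := by
  have := isProbabilityMeasure_sampleLaw hs
  rw [probLocal_eq hs]
  exact ⟨measureReal_nonneg, measureReal_le_one⟩

end SampleLaw

/-! ### From the conditional laws of a run to almost sure convergence. -/

lemma condExp_indicator_sub_const_eq_zero {Ω : Type*} {G mΩ : MeasurableSpace Ω} {μ : Measure Ω}
    [IsProbabilityMeasure μ] (hG : G ≤ mΩ) {A B : Set Ω} (hA : MeasurableSet[G] A)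
    (hB : MeasurableSet B) {r : ℝ} {f : Ω → ℝ} (h : μ⟦B | G⟧ =ᵐ[μ] f) (hf : ∀ ω ∈ A, f ω = r) :
    μ[A.indicator (B.indicator (fun _ => (1 : ℝ)) - fun _ => r) | G] =ᵐ[μ] 0 := by
  classical
  have hi1 : Integrable (B.indicator (fun _ => (1 : ℝ))) μ := (integrable_const 1).indicator hB
  have hi2 : Integrable (fun _ : Ω => r) μ := integrable_const _
  have h1 := condExp_indicator (hi1.sub hi2) hA
  have h2 := condExp_sub hi1 hi2 G
  rw [condExp_const hG] at h2
  filter_upwards [h1, h2, h] with ω e1 e2 e3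
  rw [e1, Set.indicator_apply]
  split_ifs with hω
  · rw [e2, Pi.sub_apply, e3, hf ω hω]
    simp
  · rfl

namespace IsRun

variable {Ω : Type*} [mΩ : MeasurableSpace Ω] {μ : Measure Ω}
  {ℱ : Filtration ℕ mΩ} {r₁ r₂ : ℝ} {X : ℕ → Ω → ℝ × ℝ} {F : ℕ → Ω → Bool}

lemma measurableSet_chosen (hrun : IsRun μ ℱ r₁ r₂ X F) (i : Arm) (n : ℕ) :
    MeasurableSet[ℱ (n + 1)] (chosen X i n) :=
  hrun.measurable_sample n (measurableSet_choose_eq i)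

lemma measurableSet_reward (hrun : IsRun μ ℱ r₁ r₂ X F) (n : ℕ) :
    MeasurableSet[ℱ (n + 1)] (F n ⁻¹' {true}) :=
  hrun.measurable_feedback n (MeasurableSet.singleton true)

lemma measurable_centeredReward (hrun : IsRun μ ℱ r₁ r₂ X F) (i : Arm) (r : ℝ) (n : ℕ) :
    Measurable[ℱ (n + 1)] (centeredReward X F i r n) :=
  Measurable.indicator ((Measurable.indicator measurable_const (hrun.measurableSet_reward n)).sub
    measurable_const) (hrun.measurableSet_chosen i n)

lemma condExp_chosen_offloading (hrun : IsRun μ ℱ r₁ r₂ X F) (n : ℕ) :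
    μ⟦chosen X Arm.offloading n | ℱ n⟧ =ᵐ[μ]
      fun ω => 1 - probLocal (state (fun k => X k ω) (fun k => F k ω) n) := by
  refine (hrun.sample_law n _ (measurableSet_choose_eq Arm.offloading)).trans (ae_of_all _ ?_)
  exact fun ω => sampleLaw_real_choose_offloading (pos_state _ _ n)

lemma condExp_chosen_localComputing (hrun : IsRun μ ℱ r₁ r₂ X F) (n : ℕ) :
    μ⟦chosen X Arm.localComputing n | ℱ n⟧ =ᵐ[μ]
      fun ω => probLocal (state (fun k => X k ω) (fun k => F k ω) n) := by
  refine (hrun.sample_law n _ (measurableSet_choose_eq Arm.localComputing)).trans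
    (ae_of_all _ ?_)
  exact fun ω => sampleLaw_real_choose_localComputing (pos_state _ _ n)

variable [IsProbabilityMeasure μ]

lemma condExp_centeredReward (hrun : IsRun μ ℱ r₁ r₂ X F) (i : Arm) (n : ℕ) :
    μ[centeredReward X F i (rewardProb r₁ r₂ i) n | ℱ n] =ᵐ[μ] 0 := by
  have hGle : ℱ n ⊔ MeasurableSpace.comap (X n) inferInstance ≤ mΩ := sup_le (ℱ.le n)
    ((hrun.measurable_sample n).mono (ℱ.le _) le_rfl).comap_le
  have h0 : μ[centeredReward X F i (rewardProb r₁ r₂ i) n |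
      ℱ n ⊔ MeasurableSpace.comap (X n) inferInstance] =ᵐ[μ] 0 :=
    condExp_indicator_sub_const_eq_zero hGle
      ((le_sup_right : MeasurableSpace.comap (X n) inferInstance ≤ ℱ n ⊔ _) _
        ⟨_, measurableSet_choose_eq i, rfl⟩)
      (ℱ.le _ _ (hrun.measurableSet_reward n)) (hrun.feedback_law n)
      fun ω hω => by rw [show choose (X n ω) = i from hω]
  have h1 := condExp_condExp_of_le (μ := μ) (f := centeredReward X F i (rewardProb r₁ r₂ i) n)
    le_sup_left hGle
  -- The feedback law conditions on the current samples too; the tower property descends to the past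
  -- alone.
  refine h1.symm.trans ((condExp_congr_ae h0).trans ?_)
  rw [condExp_zero]

/-- The empirical means of an arm that is chosen infinitely often converge to its reward
probability. -/
lemma ae_tendsto_alpha_div (hrun : IsRun μ ℱ r₁ r₂ X F) (hr₂ : 0 ≤ r₂) (hr₁ : r₁ ≤ 1)
    (hr : r₂ < r₁) (i : Arm) :
    ∀ᵐ ω ∂μ, Tendsto (fun n => count (chosen X i) n ω) atTop atTop →
      Tendsto (fun n => ((state (fun k => X k ω) (fun k => F k ω) n).alpha i : ℝ) /
      ((state (fun k => X k ω) (fun k => F k ω) n).alpha i +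
        (state (fun k => X k ω) (fun k => F k ω) n).beta i)) atTop
          (𝓝 (rewardProb r₁ r₂ i)) := by
  have hb : rewardProb r₁ r₂ i ∈ Set.Icc (0 : ℝ) 1 := by
    cases i <;> simp only [rewardProb, Set.mem_Icc] <;> constructor <;> linarith
  have hY : ∀ n ω, |centeredReward X F i (rewardProb r₁ r₂ i) n ω| ≤
      (chosen X i n).indicator 1 ω := fun n ω => by
    classical
    rw [centeredReward]
    simp only [Set.indicator_apply, Pi.sub_apply, Pi.one_apply]
    split_ifs
    · rw [abs_le]; constructor <;> linarith [hb.1, hb.2]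
    · rw [abs_le]; constructor <;> linarith [hb.1, hb.2]
    · simp
  filter_upwards [ae_tendsto_sum_div_count (hrun.measurableSet_chosen i)
    (hrun.measurable_centeredReward i _) hY (hrun.condExp_centeredReward i)] with ω h hc
  exact tendsto_alpha_div i _ hc (h hc)

lemma ae_tendsto_count_or (hrun : IsRun μ ℱ r₁ r₂ X F) :
    ∀ᵐ ω ∂μ, (Tendsto (fun n => count (chosen X Arm.localComputing) n ω) atTop atTop ∨
      Tendsto (fun n => probLocal (state (fun k => X k ω) (fun k => F k ω) n)) atTop (𝓝 0)) ∧
      (Tendsto (fun n => count (chosen X Arm.offloading) n ω) atTop atTop ∨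
      Tendsto (fun n => probLocal (state (fun k => X k ω) (fun k => F k ω) n)) atTop (𝓝 1)) := by
  filter_upwards [ae_tendsto_condExp_indicator_zero (hrun.measurableSet_chosen Arm.localComputing),
    ae_tendsto_condExp_indicator_zero (hrun.measurableSet_chosen Arm.offloading),
    ae_all_iff.2 hrun.condExp_chosen_localComputing,
    ae_all_iff.2 hrun.condExp_chosen_offloading] with ω h1 h2 e1 e2
  simp only [e1] at h1
  simp only [e2] at h2
  refine ⟨h1, h2.imp_right fun h => ?_⟩
  simpa using h.const_sub 1

/-- The selection probability of the optimal arm tends to one almost surely. -/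
lemma ae_tendsto_probLocal (hrun : IsRun μ ℱ r₁ r₂ X F) (hr₂ : 0 ≤ r₂) (hr₁ : r₁ ≤ 1)
    (hr : r₂ < r₁) :
    ∀ᵐ ω ∂μ, Tendsto
      (fun n => probLocal (state (fun k => X k ω) (fun k => F k ω) n)) atTop (𝓝 1) := by
  set δ := (r₁ - r₂) / 2 with hδ
  have hδ0 : 0 < δ := by linarith
  filter_upwards [hrun.ae_tendsto_count_or,
    hrun.ae_tendsto_alpha_div hr₂ hr₁ hr Arm.localComputing,
    hrun.ae_tendsto_alpha_div hr₂ hr₁ hr Arm.offloading] with ω ⟨h1, h2⟩ m1 m2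
  set s := state (fun k => X k ω) (fun k => F k ω)
  have hpos : ∀ n, (s n).Pos := pos_state _ _
  have hconc : ∀ i, Tendsto (fun n => count (chosen X i) n ω) atTop atTop →
      Tendsto (fun n => ((s n).alpha i : ℝ) / ((s n).alpha i + (s n).beta i)) atTop
        (𝓝 (rewardProb r₁ r₂ i)) →
      Tendsto (fun n => (betaMeasure ((s n).alpha i) ((s n).beta i)).real
        {x | δ ≤ |x - rewardProb r₁ r₂ i|}) atTop (𝓝 0) := by
    intro i hc hm
    refine tendsto_betaMeasure_real_abs_sub_ge (fun n => ?_) (fun n => ?_) ?_ hm hδ0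
    · cases i
      exacts [(hpos n).1, (hpos n).2.2.1]
    · cases i
      exacts [(hpos n).2.1, (hpos n).2.2.2]
    · simp only [s, alpha_add_beta_state]
      exact tendsto_atTop_add_const_right _ _ hc
  by_cases c1 : Tendsto (fun n => count (chosen X Arm.localComputing) n ω) atTop atTop
  -- If arm 2 is played finitely often the limit is already known; otherwise both laws concentrate.
  · refine h2.elim (fun c2 => ?_) id
    have h3 := (hconc _ c1 (m1 c1)).add (hconc _ c2 (m2 c2))
    rw [add_zero] at h3
    have h4 : Tendsto (fun n => 1 - probLocal (s n)) atTop (𝓝 0) :=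
      squeeze_zero (fun n => sub_nonneg.2 (probLocal_mem_Icc (hpos n)).2)
        (fun n => one_sub_probLocal_le (hpos n) (by simp only [rewardProb, hδ]; ring)) h3
    simpa using h4.const_sub 1
  · exfalso
    have hp0 := h1.resolve_left c1
    have c2 := tendsto_count_offloading c1
    have h3 := hconc _ c2 (m2 c2)
    obtain ⟨a, b, hab⟩ := exists_eventually_eq_of_not_tendsto_count F _ c1
    obtain ⟨n, ha, hb⟩ := hab.exists
    -- The threshold r₂ + δ is the midpoint of r₂ and r₁, hence below 1.
    have hC : 0 < (betaMeasure (a : ℝ) (b : ℝ)).real (Set.Ioi (r₂ + δ)) :=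
      betaMeasure_real_Ioi_pos (ha ▸ (hpos n).1) (hb ▸ (hpos n).2.1) (by linarith) (by linarith)
    have h4 := (h3.const_sub 1).const_mul ((betaMeasure (a : ℝ) (b : ℝ)).real (Set.Ioi (r₂ + δ)))
    rw [sub_zero, mul_one] at h4
    refine hC.not_ge (le_of_tendsto_of_tendsto h4 hp0 ?_)
    filter_upwards [hab] with n ⟨ha, hb⟩
    have := le_probLocal (hpos n) r₂ δ
    rwa [show (s n).alpha Arm.localComputing = a from ha,
      show (s n).beta Arm.localComputing = b from hb] at this

lemma real_choose_localComputing (hrun : IsRun μ ℱ r₁ r₂ X F) (n : ℕ) :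
    μ.real {ω | choose (X n ω) = Arm.localComputing} =
      ∫ ω, probLocal (state (fun k => X k ω) (fun k => F k ω) n) ∂μ := by
  rw [← integral_congr_ae (hrun.condExp_chosen_localComputing n), integral_condExp (ℱ.le n),
    integral_indicator_const _ (ℱ.le _ _ (hrun.measurableSet_chosen _ n)), smul_eq_mul, mul_one]
  rfl

end IsRun

end BLA

/-- If `r₁ > r₂`, then along every run of the Bayesian learning automaton the probability of
selecting local computing in the current state tends to `1` almost surely, and the unconditional
probability that local computing is selected in slot `n` tends to `1`. -/
theorem theorem2 {Ω : Type*} [mΩ : MeasurableSpace Ω] (μ : Measure Ω) [IsProbabilityMeasure μ]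
    (ℱ : Filtration ℕ mΩ) (r₁ r₂ : ℝ) (hr₂ : 0 ≤ r₂) (hr₁ : r₁ ≤ 1) (hr : r₁ > r₂)
    (X : ℕ → Ω → ℝ × ℝ) (F : ℕ → Ω → Bool) (hrun : BLA.IsRun μ ℱ r₁ r₂ X F) :
    (∀ᵐ ω ∂μ, Tendsto
      (fun n => BLA.probLocal (BLA.state (fun k => X k ω) (fun k => F k ω) n)) atTop (𝓝 1)) ∧
    Tendsto (fun n => μ.real {ω | BLA.choose (X n ω) = Arm.localComputing}) atTop (𝓝 1) := by
  have h := hrun.ae_tendsto_probLocal hr₂ hr₁ hr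
  refine ⟨h, ?_⟩
  simp only [hrun.real_choose_localComputing]
  have hlim := tendsto_integral_of_dominated_convergence (μ := μ) (fun _ => (1 : ℝ))
    -- Measurability is inherited from the almost everywhere equal conditional expectation.
    (fun n => stronglyMeasurable_condExp.mono (ℱ.le n) |>.aestronglyMeasurable.congr
      (hrun.condExp_chosen_localComputing n)) (integrable_const 1)
    (fun n => ae_of_all _ fun ω => by
      have := BLA.probLocal_mem_Icc (BLA.pos_state (fun k => X k ω) (fun k => F k ω) n)
      rw [Real.norm_of_nonneg this.1]
      exact this.2) h
  simpa using hlim
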